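/- Let $\mathbb{O}$ be the octonions with standard basis $e_0=1,e_1,\dots,e_7$. An $\mathbb{O}$-bimodule is a real vector space $M$ with unital $\mathbb{R}$-bilinear left and right multiplications by $\mathbb{O}$ such that $[p,q,x]=[q,x,p]=[x,p,q]=-[q,p,x]$ for all $p,q\in\mathbb{O}$, $x\in M$, where $[a,b,c]=(ab)c-a(bc)$. Its real part is $\operatorname{Re}M=\{m\in M:[p,q,m]=0\ \forall p,q\in\mathbb{O}\}$, with the projection $\operatorname{Re}m=\frac{5}{12}m-\frac1{12}\sum_{i=1}^7 e_i m e_i$. An $\mathbb{R}$-linear map $f:M\to M'$ between $\mathbb{O}$-bimodules is right para-linear if $\operatorname{Re}B_p(f,x)=0$ for all $p\in\mathbb{O}$, $x\in M$, where $B_p(f,x)=f(x)p-f(xp)$. Let $H$ be a Hilbert $\mathbb{O}$-bimodule, that is, an $\mathbb{O}$-bimodule with an $\mathbb{R}$-bilinear map $\langle\cdot,\cdot\rangle:H\times H\to\mathbb{O}$ such that each $\langle u,\cdot\rangle$ is right para-linear, $\langle u,v\rangle=\overline{\langle v,u\rangle}$, $\langle u,u\rangle$ is real and $\ge 0$ and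 vanishes only for $u=0$, and $H$ is complete for the norm $\|u\|=\sqrt{\langle u,u\rangle}$. Put $B_p(u,v)=\langle u,v\rangle p-\langle u,vp\rangle$, and let $\mathbb{C}(H)=\bigcup_{J}(\operatorname{Re}H+J\operatorname{Re}H)$ be the slice cone, the union being over the imaginary octonions $J$ with $|J|=1$. For a bounded $\mathbb{R}$-linear operator $T:H\to H$ and $x,y\in H$ put $$(\langle y,\cdot\rangle\circledcirc T)(x)=\sum_{i=0}^7 e_i\operatorname{Re}\langle y,T(x\overline{e_i})\rangle,\qquad [y,T,x]=(\langle y,\cdot\rangle\circledcirc T)(x)-\langle y,Tx\rangle,$$ and let $T^*y$ be the unique vector with $\langle T^*y,x\rangle=(\langle y,\cdot\rangle\circledcirc T)(x)$ for all $x\in H$. A strong eigenvector of $T$ with strong eigenvalue $\lambda\in\mathbb{O}$ is a nonzero $z\in\mathbb{C}(H)$ with $Tz=z\lambda$. **Theorem.** Let $T$ be a bounded right para-linear operator on $H$ with $T=T^*$. (a) Every strong eigenvalue of $T$ is real. (b) Let $z_1,z_2$ be strong eigenvectors of $T$ with strong eigenvalues $\lambda_1\neq\lambda_2$. Then 1.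 $[z_2,T,z_1]=0$; 2. $\langle z_1,z_2\rangle=0$; 3. $B_p(z_1,z_2)=0$ for all $p\in\mathbb{O}$; moreover, the normalized family $(u_1,u_2)=(z_1/\|z_1\|,z_2/\|z_2\|)$ is weak associative orthonormal, i.e. $\langle u_a,u_b\rangle=\delta_{ab}$ and $B_p(u_a,u_b)=0$ for all $a,b\in\{1,2\}$ and $p\in\mathbb{O}$. -/

import Mathlib

/-- The octonions: eight real coordinates with respect to `e₀ = 1, e₁, …, e₇`. -/
def Octonion : Type := Fin 8 → ℝ

namespace Octonion

noncomputable instance : AddCommGroup Octonion := inferInstanceAs (AddCommGroup (Fin 8 → ℝ))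
noncomputable instance : Module ℝ Octonion := inferInstanceAs (Module ℝ (Fin 8 → ℝ))

/-- The standard basis `e₀, …, e₇`. -/
noncomputable def e (i : Fin 8) : Octonion := Pi.single (M := fun _ : Fin 8 => ℝ) i 1

noncomputable instance : One Octonion := ⟨e 0⟩

/-- Octonion multiplication for the oriented Fano triples
(123), (145), (176), (246), (257), (347), (365). -/
noncomputable instance : Mul Octonion := ⟨fun x y =>
  ![x 0 * y 0 - x 1 * y 1 - x 2 * y 2 - x 3 * y 3 - x 4 * y 4 - x 5 * y 5 - x 6 * y 6 - x 7 * y 7,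
    x 0 * y 1 + x 1 * y 0 + x 2 * y 3 - x 3 * y 2 + x 4 * y 5 - x 5 * y 4 - x 6 * y 7 + x 7 * y 6,
    x 0 * y 2 - x 1 * y 3 + x 2 * y 0 + x 3 * y 1 + x 4 * y 6 + x 5 * y 7 - x 6 * y 4 - x 7 * y 5,
    x 0 * y 3 + x 1 * y 2 - x 2 * y 1 + x 3 * y 0 + x 4 * y 7 - x 5 * y 6 + x 6 * y 5 - x 7 * y 4,
    x 0 * y 4 - x 1 * y 5 - x 2 * y 6 - x 3 * y 7 + x 4 * y 0 + x 5 * y 1 + x 6 * y 2 + x 7 * y 3,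
    x 0 * y 5 + x 1 * y 4 - x 2 * y 7 + x 3 * y 6 - x 4 * y 1 + x 5 * y 0 - x 6 * y 3 + x 7 * y 2,
    x 0 * y 6 + x 1 * y 7 + x 2 * y 4 - x 3 * y 5 - x 4 * y 2 + x 5 * y 3 + x 6 * y 0 - x 7 * y 1,
    x 0 * y 7 - x 1 * y 6 + x 2 * y 5 + x 3 * y 4 - x 4 * y 3 - x 5 * y 2 + x 6 * y 1 + x 7 * y 0]⟩

/-- Octonionic conjugation. -/
noncomputable def conj (x : Octonion) : Octonion :=
  ![x 0, -x 1, -x 2, -x 3, -x 4, -x 5, -x 6, -x 7]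

/-- The real number `r` as an octonion. -/
noncomputable def ofReal (r : ℝ) : Octonion := r • (1 : Octonion)

/-- The modulus `|x| = √(x x̄)` (the octonion `x x̄` is real). -/
noncomputable def modulus (x : Octonion) : ℝ := Real.sqrt ((x * conj x) 0)

/-- The sphere of unit imaginary octonions. -/
def imSphere : Set Octonion := {J | J 0 = 0 ∧ modulus J = 1}

theorem ext8 {x y : Octonion} (h0 : x 0 = y 0) (h1 : x 1 = y 1) (h2 : x 2 = y 2) (h3 : x 3 = y 3)
    (h4 : x 4 = y 4) (h5 : x 5 = y 5) (h6 : x 6 = y 6) (h7 : x 7 = y 7) : x = y := by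
  funext i
  fin_cases i
  exacts [h0, h1, h2, h3, h4, h5, h6, h7]

theorem add_coord (x y : Octonion) (i : Fin 8) : (x + y) i = x i + y i := rfl
theorem sub_coord (x y : Octonion) (i : Fin 8) : (x - y) i = x i - y i := rfl
theorem neg_coord (x : Octonion) (i : Fin 8) : (-x) i = -x i := rfl
theorem zero_coord (i : Fin 8) : (0 : Octonion) i = 0 := rfl
theorem smul_coord (r : ℝ) (x : Octonion) (i : Fin 8) : (r • x) i = r * x i := rfl
theorem one_coord (i : Fin 8) : (1 : Octonion) i = if i = 0 then 1 else 0 :=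
  Pi.single_apply (M := ℝ) (0 : Fin 8) 1 i
theorem e_coord (j i : Fin 8) : e j i = if i = j then 1 else 0 :=
  Pi.single_apply (M := ℝ) j 1 i
theorem mul_coord0 (x y : Octonion) : (x * y) 0 =
    x 0 * y 0 - x 1 * y 1 - x 2 * y 2 - x 3 * y 3 - x 4 * y 4 - x 5 * y 5 - x 6 * y 6 - x 7 * y 7 := rfl
theorem mul_coord1 (x y : Octonion) : (x * y) 1 =
    x 0 * y 1 + x 1 * y 0 + x 2 * y 3 - x 3 * y 2 + x 4 * y 5 - x 5 * y 4 - x 6 * y 7 + x 7 * y 6 := rfl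
theorem mul_coord2 (x y : Octonion) : (x * y) 2 =
    x 0 * y 2 - x 1 * y 3 + x 2 * y 0 + x 3 * y 1 + x 4 * y 6 + x 5 * y 7 - x 6 * y 4 - x 7 * y 5 := rfl
theorem mul_coord3 (x y : Octonion) : (x * y) 3 =
    x 0 * y 3 + x 1 * y 2 - x 2 * y 1 + x 3 * y 0 + x 4 * y 7 - x 5 * y 6 + x 6 * y 5 - x 7 * y 4 := rfl
theorem mul_coord4 (x y : Octonion) : (x * y) 4 =
    x 0 * y 4 - x 1 * y 5 - x 2 * y 6 - x 3 * y 7 + x 4 * y 0 + x 5 * y 1 + x 6 * y 2 + x 7 * y 3 := rfl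
theorem mul_coord5 (x y : Octonion) : (x * y) 5 =
    x 0 * y 5 + x 1 * y 4 - x 2 * y 7 + x 3 * y 6 - x 4 * y 1 + x 5 * y 0 - x 6 * y 3 + x 7 * y 2 := rfl
theorem mul_coord6 (x y : Octonion) : (x * y) 6 =
    x 0 * y 6 + x 1 * y 7 + x 2 * y 4 - x 3 * y 5 - x 4 * y 2 + x 5 * y 3 + x 6 * y 0 - x 7 * y 1 := rfl
theorem mul_coord7 (x y : Octonion) : (x * y) 7 =
    x 0 * y 7 - x 1 * y 6 + x 2 * y 5 + x 3 * y 4 - x 4 * y 3 - x 5 * y 2 + x 6 * y 1 + x 7 * y 0 := rfl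
theorem conj_coord0 (x : Octonion) : conj x 0 = x 0 := rfl
theorem conj_coord1 (x : Octonion) : conj x 1 = -x 1 := rfl
theorem conj_coord2 (x : Octonion) : conj x 2 = -x 2 := rfl
theorem conj_coord3 (x : Octonion) : conj x 3 = -x 3 := rfl
theorem conj_coord4 (x : Octonion) : conj x 4 = -x 4 := rfl
theorem conj_coord5 (x : Octonion) : conj x 5 = -x 5 := rfl
theorem conj_coord6 (x : Octonion) : conj x 6 = -x 6 := rfl
theorem conj_coord7 (x : Octonion) : conj x 7 = -x 7 := rfl

/-- Octonion multiplication as a real bilinear map. -/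
noncomputable def mulBilin : Octonion →ₗ[ℝ] Octonion →ₗ[ℝ] Octonion :=
  LinearMap.mk₂ ℝ (fun x y => x * y)
    (fun x y z => by
      apply ext8 <;> simp [mul_coord0, mul_coord1, mul_coord2, mul_coord3, mul_coord4, mul_coord5,
          mul_coord6, mul_coord7, add_coord] <;> ring)
    (fun r x y => by
      apply ext8 <;> simp [mul_coord0, mul_coord1, mul_coord2, mul_coord3, mul_coord4, mul_coord5,
          mul_coord6, mul_coord7, smul_coord] <;> ring)
    (fun x y z => by
      apply ext8 <;> simp [mul_coord0, mul_coord1, mul_coord2, mul_coord3, mul_coord4, mul_coord5,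
          mul_coord6, mul_coord7, add_coord] <;> ring)
    (fun r x y => by
      apply ext8 <;> simp [mul_coord0, mul_coord1, mul_coord2, mul_coord3, mul_coord4, mul_coord5,
          mul_coord6, mul_coord7, smul_coord] <;> ring)

theorem mulBilin_apply (x y : Octonion) : mulBilin x y = x * y := rfl

/-- The associator of `𝕆` is invariant under cyclic permutations. -/
theorem assoc_cycl (p q x : Octonion) :
    (p * q) * x - p * (q * x) = (q * x) * p - q * (x * p) := by
  apply ext8 <;>
    simp only [sub_coord, mul_coord0, mul_coord1, mul_coord2, mul_coord3, 
      mul_coord4, mul_coord5, mul_coord6, mul_coord7] <;> ring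

/-- The associator of `𝕆` changes sign when the first two entries are exchanged. -/
theorem assoc_swap (p q x : Octonion) :
    (p * q) * x - p * (q * x) = -((q * p) * x - q * (p * x)) := by
  apply ext8 <;>
    simp only [sub_coord, neg_coord, mul_coord0, mul_coord1, mul_coord2, mul_coord3, 
      mul_coord4, mul_coord5, mul_coord6, mul_coord7] <;> ring

protected theorem mul_one (x : Octonion) : x * 1 = x := by
  apply ext8 <;>
    simp [one_coord, mul_coord0, mul_coord1, mul_coord2, mul_coord3, 
      mul_coord4, mul_coord5, mul_coord6, mul_coord7]

protected theorem one_mul (x : Octonion) : 1 * x = x := by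
  apply ext8 <;>
    simp [one_coord, mul_coord0, mul_coord1, mul_coord2, mul_coord3, 
      mul_coord4, mul_coord5, mul_coord6, mul_coord7]

end Octonion

/-- A (unital) right `𝕆`-module: a real vector space with a bilinear right multiplication
`rmul x p = x p` whose right associator `(x p) q - x (p q)` is alternating in `p, q`. -/
class OctRightModule (M : Type*) [AddCommGroup M] [Module ℝ M] where
  rmul : M →ₗ[ℝ] Octonion →ₗ[ℝ] M
  rmul_one : ∀ x : M, rmul x 1 = x
  rmul_alt : ∀ (x : M) (p q : Octonion),
    rmul (rmul x p) q - rmul x (p * q) = -(rmul (rmul x q) p - rmul x (q * p))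

/-- A (unital) `𝕆`-bimodule: a right `𝕆`-module with a bilinear left multiplication
`lmul p x = p x` such that `[p,q,x] = [q,x,p] = [x,p,q] = -[q,p,x]`. -/
class OctBimodule (M : Type*) [AddCommGroup M] [Module ℝ M] extends OctRightModule M where
  lmul : Octonion →ₗ[ℝ] M →ₗ[ℝ] M
  one_lmul : ∀ x : M, lmul 1 x = x
  left_eq_middle : ∀ (p q : Octonion) (x : M),
    lmul (p * q) x - lmul p (lmul q x) = rmul (lmul q x) p - lmul q (rmul x p)
  left_eq_right : ∀ (p q : Octonion) (x : M),
    lmul (p * q) x - lmul p (lmul q x) = rmul (rmul x p) q - rmul x (p * q)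
  left_alt : ∀ (p q : Octonion) (x : M),
    lmul (p * q) x - lmul p (lmul q x) = -(lmul (q * p) x - lmul q (lmul p x))

open OctRightModule OctBimodule

/-- The regular bimodule: `𝕆` acting on itself by multiplication. -/
noncomputable instance Octonion.instOctBimodule : OctBimodule Octonion where
  rmul := Octonion.mulBilin
  rmul_one := Octonion.mul_one
  rmul_alt x p q := by
    simp only [Octonion.mulBilin_apply]
    rw [Octonion.assoc_cycl x p q, Octonion.assoc_cycl x q p, Octonion.assoc_swap p q x]
  lmul := Octonion.mulBilin
  one_lmul := Octonion.one_mul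
  left_eq_middle := Octonion.assoc_cycl
  left_eq_right p q x := (Octonion.assoc_cycl x p q).symm
  left_alt := Octonion.assoc_swap

section Bimodule

/-- The real part `Re M = {m | [p,q,m] = 0 for all p, q}` of an `𝕆`-bimodule. -/
def octRe (M : Type*) [AddCommGroup M] [Module ℝ M] [OctBimodule M] : Set M :=
  {m | ∀ p q : Octonion, lmul (p * q) m - lmul p (lmul q m) = 0}

/-- The real part operator `Re m = (5/12) m - (1/12) ∑_{i=1}^7 e_i m e_i`. -/
noncomputable def reOp {M : Type*} [AddCommGroup M] [Module ℝ M] [OctBimodule M] (m : M) : M :=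
  (5 / 12 : ℝ) • m -
    (1 / 12 : ℝ) • ∑ i : Fin 7, rmul (lmul (Octonion.e i.succ) m) (Octonion.e i.succ)

/-- The second right associator `B_p(f, x) = f(x) p - f(x p)`. -/
noncomputable def secondAssoc {M M' : Type*} [AddCommGroup M] [Module ℝ M] [OctRightModule M]
    [AddCommGroup M'] [Module ℝ M'] [OctRightModule M']
    (p : Octonion) (f : M →ₗ[ℝ] M') (x : M) : M' :=
  rmul (f x) p - f (rmul x p)

/-- Right para-linearity: `Re B_p(f, x) = 0` for all `p` and `x`. -/
def IsRightParaLinear {M M' : Type*} [AddCommGroup M] [Module ℝ M] [OctRightModule M]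
    [AddCommGroup M'] [Module ℝ M'] [OctBimodule M'] (f : M →ₗ[ℝ] M') : Prop :=
  ∀ (p : Octonion) (x : M), reOp (secondAssoc p f x) = 0

/-- The regular composition `(f ⊚ g)(x) = ∑_{i=0}^7 e_i Re(f(g(x ē_i)))`. -/
noncomputable def regularComp {M M' M'' : Type*} [AddCommGroup M] [Module ℝ M] [OctRightModule M]
    [AddCommGroup M'] [Module ℝ M'] [AddCommGroup M''] [Module ℝ M''] [OctBimodule M'']
    (f : M' →ₗ[ℝ] M'') (g : M →ₗ[ℝ] M') (x : M) : M'' :=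
  ∑ i : Fin 8, lmul (Octonion.e i) (reOp (f (g (rmul x (Octonion.conj (Octonion.e i))))))

/-- The composition associator `[f, g, x] = (f ⊚ g)(x) - f(g(x))`. -/
noncomputable def compAssoc {M M' M'' : Type*} [AddCommGroup M] [Module ℝ M] [OctRightModule M]
    [AddCommGroup M'] [Module ℝ M'] [AddCommGroup M''] [Module ℝ M''] [OctBimodule M'']
    (f : M' →ₗ[ℝ] M'') (g : M →ₗ[ℝ] M') (x : M) : M'' :=
  regularComp f g x - f (g x)

theorem Octonion.reOp_eq (x : Octonion) : reOp x = Octonion.ofReal (x 0) := by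
  have hl : ∀ a b : Octonion, lmul a b = a * b := fun _ _ => rfl
  have hr : ∀ a b : Octonion, rmul a b = a * b := fun _ _ => rfl
  unfold reOp Octonion.ofReal
  rw [Fin.sum_univ_seven]
  simp only [hl, hr]
  apply Octonion.ext8 <;>
        simp [Octonion.mul_coord0, Octonion.mul_coord1, Octonion.mul_coord2, Octonion.mul_coord3,
          Octonion.mul_coord4, Octonion.mul_coord5, Octonion.mul_coord6, Octonion.mul_coord7,
          Octonion.sub_coord, Octonion.add_coord, Octonion.smul_coord,
      Octonion.e_coord, Octonion.one_coord] <;> ring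

end Bimodule

/-- An `𝕆`-bimodule with a right `𝕆`-inner product `oinner u v = ⟨u, v⟩`, on a real inner product
space whose real inner product is `Re ⟨u, v⟩`; thus the norm is `‖u‖ = √⟨u, u⟩`.
With `[CompleteSpace H]` this is a Hilbert `𝕆`-bimodule. -/
class OctPreHilbertBimodule (H : Type*) [NormedAddCommGroup H] [InnerProductSpace ℝ H]
    extends OctBimodule H where
  oinner : H →ₗ[ℝ] H →ₗ[ℝ] Octonion
  oinner_para : ∀ u : H, IsRightParaLinear (oinner u)
  oinner_conj : ∀ u v : H, oinner u v = Octonion.conj (oinner v u)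
  oinner_pos : ∀ u : H, ∃ r : ℝ, 0 ≤ r ∧ oinner u u = Octonion.ofReal r
  oinner_self_eq_zero : ∀ u : H, oinner u u = 0 ↔ u = 0
  re_oinner : ∀ u v : H, (oinner u v) 0 = inner ℝ u v

open OctPreHilbertBimodule

section Hilbert

variable {H : Type*} [NormedAddCommGroup H] [InnerProductSpace ℝ H] [OctPreHilbertBimodule H]

/-- `B_p(u, v) = B_p(⟨u, ·⟩, v) = ⟨u, v⟩ p - ⟨u, v p⟩`. -/
noncomputable def innerAssoc (p : Octonion) (u v : H) : Octonion :=
  secondAssoc p (oinner u) v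

/-- The triple associator `[y, T, x] = [⟨y, ·⟩, T, x] = (⟨y, ·⟩ ⊚ T)(x) - ⟨y, T x⟩`. -/
noncomputable def tripleAssoc (y : H) (T : H →L[ℝ] H) (x : H) : Octonion :=
  compAssoc (oinner y) T.toLinearMap x

/-- For every `y` there is a unique `z` representing the functional `⟨y, ·⟩ ⊚ T`. -/
theorem existsUnique_adjoint [CompleteSpace H] (T : H →L[ℝ] H) (y : H) :
    ∃! z : H, ∀ x : H, oinner z x = regularComp (oinner y) T.toLinearMap x := by
  set z : H := (InnerProductSpace.toDual ℝ H).symm ((innerSL ℝ y).comp T) with hz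
  have hzx : ∀ x : H, inner ℝ z x = inner ℝ y (T x) := by
    intro x
    rw [hz, InnerProductSpace.toDual_symm_apply]
    simp
  have hpara : ∀ (u x : H) (p : Octonion),
      (oinner u (rmul x p)) 0 = ((oinner u x) * p) 0 := by
    intro u x p
    have h := oinner_para u p x
    rw [Octonion.reOp_eq] at h
    have h0 := congrFun h 0
    have h1 : (Octonion.ofReal ((secondAssoc p (oinner u) x) 0)) 0
        = ((oinner u x) * p) 0 - (oinner u (rmul x p)) 0 := by
      simp [Octonion.ofReal, Octonion.smul_coord, Octonion.one_coord, secondAssoc,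
        Octonion.sub_coord]
      rfl
    have h2 : ((oinner u x) * p) 0 - (oinner u (rmul x p)) 0 = 0 := h1.symm.trans h0
    linarith
  refine ⟨z, ?_, ?_⟩
  · intro x
    have hl : ∀ a b : Octonion, lmul a b = a * b := fun _ _ => rfl
    have key : ∀ i : Fin 8, (oinner y (T (rmul x (Octonion.conj (Octonion.e i))))) 0
        = ((oinner z x) * Octonion.conj (Octonion.e i)) 0 := by
      intro i
      rw [re_oinner, ← hzx, ← re_oinner, hpara]
    unfold regularComp
    simp only [hl, Octonion.reOp_eq, ContinuousLinearMap.coe_coe, key]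
    rw [Fin.sum_univ_eight]
    apply Octonion.ext8 <;>
        simp [Octonion.mul_coord0, Octonion.mul_coord1, Octonion.mul_coord2, Octonion.mul_coord3,
          Octonion.mul_coord4, Octonion.mul_coord5, Octonion.mul_coord6, Octonion.mul_coord7,
          Octonion.add_coord, Octonion.ofReal, Octonion.smul_coord,
      Octonion.conj_coord0, Octonion.conj_coord1, Octonion.conj_coord2, Octonion.conj_coord3,
          Octonion.conj_coord4, Octonion.conj_coord5, Octonion.conj_coord6, Octonion.conj_coord7,
          Octonion.e_coord, Octonion.one_coord]
  · intro w hw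
    have hre : ∀ x : H, inner ℝ w x = inner ℝ z x := by
      intro x
      have h3 : ∀ x : H, oinner w x = regularComp (oinner y) T.toLinearMap x := hw
      have hl : ∀ a b : Octonion, lmul a b = a * b := fun _ _ => rfl
      rw [← re_oinner, h3 x, hzx]
      unfold regularComp
      simp only [hl, Octonion.reOp_eq, ContinuousLinearMap.coe_coe]
      rw [Fin.sum_univ_eight]
      have h1 : Octonion.conj (Octonion.e 0) = 1 := by
        apply Octonion.ext8 <;>
        simp [Octonion.conj_coord0, Octonion.conj_coord1, Octonion.conj_coord2,
          Octonion.conj_coord3, Octonion.conj_coord4, Octonion.conj_coord5, Octonion.conj_coord6,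
          Octonion.conj_coord7, Octonion.e_coord, Octonion.one_coord]
      simp [Octonion.mul_coord0, Octonion.add_coord, Octonion.ofReal, Octonion.smul_coord,
        Octonion.e_coord, Octonion.one_coord, h1, rmul_one, re_oinner]
    exact ext_inner_right ℝ hre

/-- The adjoint `T*`: `T* y` is the unique vector with `⟨T* y, x⟩ = (⟨y, ·⟩ ⊚ T)(x)` for all `x`,
i.e. `⟨T* y, x⟩ = ⟨y, T x⟩ + [y, T, x]`. -/
noncomputable def octAdjoint [CompleteSpace H] (T : H →L[ℝ] H) (y : H) : H :=
  (existsUnique_adjoint T y).choose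

theorem octAdjoint_spec [CompleteSpace H] (T : H →L[ℝ] H) (y x : H) :
    oinner (octAdjoint T y) x = regularComp (oinner y) T.toLinearMap x :=
  (existsUnique_adjoint T y).choose_spec.1 x

/-- `T = T*`. -/
def IsOctSelfAdjoint [CompleteSpace H] (T : H →L[ℝ] H) : Prop :=
  ∀ y : H, T y = octAdjoint T y

/-- The slice cone `ℂ(H) = ⋃_J (Re H + J Re H)`. -/
def sliceCone (H : Type*) [NormedAddCommGroup H] [InnerProductSpace ℝ H]
    [OctPreHilbertBimodule H] : Set H :=
  {z | ∃ J ∈ Octonion.imSphere, ∃ u ∈ octRe H, ∃ v ∈ octRe H, z = u + lmul J v}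

/-- `z` is a strong eigenvector of `T` with strong eigenvalue `lam`: a nonzero slice paravector
with `T z = z lam`. -/
def IsStrongEigenpair (T : H →L[ℝ] H) (lam : Octonion) (z : H) : Prop :=
  z ∈ sliceCone H ∧ z ≠ 0 ∧ T z = rmul z lam

/-- Orthonormal families: `⟨x_a, x_b⟩ = δ_ab`. -/
def IsOctOrthonormal {ι : Type*} (x : ι → H) : Prop :=
  (∀ a, oinner (x a) (x a) = 1) ∧ ∀ a b, a ≠ b → oinner (x a) (x b) = 0

/-- Weak associative orthonormal families: orthonormal, with `B_p(x_a, x_b) = 0` throughout. -/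
def IsWeakAssocOrthonormal {ι : Type*} (x : ι → H) : Prop :=
  IsOctOrthonormal x ∧ ∀ (a b : ι) (p : Octonion), innerAssoc p (x a) (x b) = 0

end Hilbert

/-! ### Octonion identities: trace form, associators, relations among two units. -/

namespace Octonion

/-! Vectors of `Re H` associate and commute with all octonions, so slice paravectors can be written
`z₁ = u₁ + v₁ J` and `z₂ = u₂ + v₂ K` with real `u`, `v`. Against a real vector the real inner
product sees no para-linearity defect. Hence `⟨u q, T (v p)⟩ = q̄ (⟨u, T v⟩ p)` for real `u`, `v`
(`IsRightParaLinear.oinner_rmul_rmul`), and `⟨u, v⟩` itself is real.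

Since `T = T*` makes `T` symmetric for the real inner product, expanding both sides leaves one
associator: `⟨z₂, T z₁⟩ - ⟨T z₂, z₁⟩ = [K, a, J]` with `a = ⟨v₂, T v₁⟩` (`oinner_apply_sub_slice`).
For `z₁ = z₂` it is `[J, a, J] = 0`, which forces eigenvalues to be real. For real eigenvalues `r₁ ≠
r₂` it equals `(r₁ - r₂) ⟨z₂, z₁⟩`; but `⟨z₂, z₁⟩` lies in the span of `1, J, K, K J`, which is
orthogonal to `[K, a, J]`, so it vanishes.

Finally `B_p(z₂, z₁) = -⟨v₂, v₁⟩ [K, J, p]`, and `⟨z₂, z₁⟩ = 0` is a linear relation among `1, J, K,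
K J` with `-⟨v₂, v₁⟩` as coefficient of `K J`: either this is zero, or `K` lies in the span of `1,
J` and the associator dies. -/

theorem lmul_eq (x y : Octonion) : lmul x y = x * y := rfl

theorem rmul_eq (x y : Octonion) : rmul x y = x * y := rfl

theorem conj_conj (x : Octonion) : conj (conj x) = x := by
  apply ext8 <;> simp [conj_coord0, conj_coord1, conj_coord2, conj_coord3, conj_coord4,
    conj_coord5, conj_coord6, conj_coord7]

theorem conj_mul (x y : Octonion) : conj (x * y) = conj y * conj x := by
  apply ext8 <;>
    simp only [conj_coord0, conj_coord1, conj_coord2, conj_coord3, conj_coord4,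
      conj_coord5, conj_coord6, conj_coord7, mul_coord0, mul_coord1, mul_coord2, mul_coord3,
      mul_coord4, mul_coord5, mul_coord6, mul_coord7] <;> ring

theorem re_mul_comm (x y : Octonion) : (x * y) 0 = (y * x) 0 := by
  simp only [mul_coord0]; ring

theorem re_mul_assoc (x y z : Octonion) : ((x * y) * z) 0 = (x * (y * z)) 0 := by
  simp only [mul_coord0, mul_coord1, mul_coord2, mul_coord3, mul_coord4, mul_coord5, mul_coord6,
    mul_coord7]
  ring

/-- Nondegeneracy of the trace form. It reduces octonionic identities to real ones, where
para-linearity gives information. -/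
theorem ext_of_re_mul {x y : Octonion} (h : ∀ p, (x * p) 0 = (y * p) 0) : x = y := by
  apply ext8
  · simpa [mul_coord0, e_coord] using h (e 0)
  · simpa [mul_coord0, e_coord] using h (e 1)
  · simpa [mul_coord0, e_coord] using h (e 2)
  · simpa [mul_coord0, e_coord] using h (e 3)
  · simpa [mul_coord0, e_coord] using h (e 4)
  · simpa [mul_coord0, e_coord] using h (e 5)
  · simpa [mul_coord0, e_coord] using h (e 6)
  · simpa [mul_coord0, e_coord] using h (e 7)

theorem eq_zero_of_conj_mul_self {x : Octonion} (h : (conj x * x) 0 = 0) : x = 0 := by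
  simp only [mul_coord0, conj_coord0, conj_coord1, conj_coord2, conj_coord3, conj_coord4,
    conj_coord5, conj_coord6, conj_coord7] at h
  apply ext8 <;> rw [zero_coord] <;> refine pow_eq_zero_iff (two_ne_zero) |>.mp ?_ <;>
    nlinarith [sq_nonneg (x 0), sq_nonneg (x 1), sq_nonneg (x 2), sq_nonneg (x 3),
      sq_nonneg (x 4), sq_nonneg (x 5), sq_nonneg (x 6), sq_nonneg (x 7)]

theorem e_mul_e_self (i : Fin 7) : e i.succ * e i.succ = -1 := by
  fin_cases i <;> apply ext8 <;>
    simp [mul_coord0, mul_coord1, mul_coord2, mul_coord3, mul_coord4, mul_coord5, mul_coord6,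
      mul_coord7, neg_coord, e_coord, one_coord]

/-- `𝕆` is spanned by `1` and its associators. -/
theorem eq_top_of_one_mem_of_assoc_mem {S : Submodule ℝ Octonion} (h1 : 1 ∈ S)
    (ha : ∀ p q r : Octonion, (p * q) * r - p * (q * r) ∈ S) : S = ⊤ := by
  -- The associator of three basis units not on a common Fano line is plus or minus twice a unit;
  -- the triples below are ordered to give `+2`.
  have key : ∀ i j k l : Fin 8,
      (e i * e j) * e k - e i * (e j * e k) = (2 : ℝ) • e l → e l ∈ S := by
    intro i j k l h
    have := S.smul_mem (1 / 2 : ℝ) (ha (e i) (e j) (e k))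
    rw [h, smul_smul] at this
    simpa using this
  have he : ∀ l : Fin 8, e l ∈ S := by
    intro l
    fin_cases l
    · exact h1
    · apply key 2 5 6
      apply ext8 <;> norm_num [mul_coord0, mul_coord1, mul_coord2, mul_coord3, mul_coord4,
        mul_coord5, mul_coord6, mul_coord7, sub_coord, smul_coord, e_coord, Fin.ext_iff]
    · apply key 1 4 7
      apply ext8 <;> norm_num [mul_coord0, mul_coord1, mul_coord2, mul_coord3, mul_coord4,
        mul_coord5, mul_coord6, mul_coord7, sub_coord, smul_coord, e_coord, Fin.ext_iff]
    · apply key 1 6 4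
      apply ext8 <;> norm_num [mul_coord0, mul_coord1, mul_coord2, mul_coord3, mul_coord4,
        mul_coord5, mul_coord6, mul_coord7, sub_coord, smul_coord, e_coord, Fin.ext_iff]
    · apply key 1 3 6
      apply ext8 <;> norm_num [mul_coord0, mul_coord1, mul_coord2, mul_coord3, mul_coord4,
        mul_coord5, mul_coord6, mul_coord7, sub_coord, smul_coord, e_coord, Fin.ext_iff]
    · apply key 1 2 6
      apply ext8 <;> norm_num [mul_coord0, mul_coord1, mul_coord2, mul_coord3, mul_coord4,
        mul_coord5, mul_coord6, mul_coord7, sub_coord, smul_coord, e_coord, Fin.ext_iff]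
    · apply key 1 4 3
      apply ext8 <;> norm_num [mul_coord0, mul_coord1, mul_coord2, mul_coord3, mul_coord4,
        mul_coord5, mul_coord6, mul_coord7, sub_coord, smul_coord, e_coord, Fin.ext_iff]
    · apply key 1 2 4
      apply ext8 <;> norm_num [mul_coord0, mul_coord1, mul_coord2, mul_coord3, mul_coord4,
        mul_coord5, mul_coord6, mul_coord7, sub_coord, smul_coord, e_coord, Fin.ext_iff]
  refine Submodule.eq_top_iff'.mpr fun x => ?_
  have hx : x = ∑ i, x i • e i := by
    rw [Fin.sum_univ_eight]
    apply ext8 <;> simp [add_coord, smul_coord, e_coord]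
  rw [hx]
  exact S.sum_mem fun i _ => S.smul_mem _ (he i)

/-- The octonions generated by `J` and `K` are orthogonal to the associators `[K, a, J]`. -/
theorem re_conj_mul_assoc_eq_zero {J K : Octonion} (hJ : J 0 = 0) (hK : K 0 = 0) (a : Octonion)
    (g₀ g₁ g₂ g₃ : ℝ) :
    (conj (g₀ • (1 : Octonion) + g₁ • J - g₂ • K - g₃ • (K * J)) *
      ((K * a) * J - K * (a * J))) 0 = 0 := by
  -- Conceptually, `Re (x̄ [K, a, J])` alternates in the imaginary parts of its four arguments, and
  -- `[x, K, J] = 0` for `x` generated by `J` and `K`.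
  simp only [mul_coord0, mul_coord1, mul_coord2, mul_coord3, mul_coord4, mul_coord5, mul_coord6,
    mul_coord7, conj_coord0, conj_coord1, conj_coord2, conj_coord3, conj_coord4,
    conj_coord5, conj_coord6, conj_coord7, add_coord, sub_coord, smul_coord, one_coord, hJ, hK,
    Fin.ext_iff]
  norm_num
  ring

theorem mul_self_mul (x y : Octonion) : (x * x) * y = x * (x * y) := by
  apply ext8 <;>
    simp only [mul_coord0, mul_coord1, mul_coord2, mul_coord3, mul_coord4, mul_coord5, mul_coord6,
      mul_coord7] <;> ring

theorem mul_mul_self (x y : Octonion) : (x * y) * y = x * (y * y) := by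
  apply ext8 <;>
    simp only [mul_coord0, mul_coord1, mul_coord2, mul_coord3, mul_coord4, mul_coord5, mul_coord6,
      mul_coord7] <;> ring

/-- If `1, J, K, K J` satisfy a linear relation, either the coefficient of `K J` vanishes or `J`
and `K` associate with everything. -/
theorem smul_assoc_eq_zero {J K : Octonion} (hJ : J * J = -1) (g₀ g₁ g₂ g₃ : ℝ)
    (h : g₀ • (1 : Octonion) + g₁ • J - g₂ • K - g₃ • (K * J) = 0) (p : Octonion) :
    g₃ • ((K * J) * p - K * (J * p)) = 0 := by
  by_cases hg : g₃ = 0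
  · rw [hg, zero_smul]
  have hN : g₂ ^ 2 + g₃ ^ 2 ≠ 0 := by positivity
  -- The relation reads `K (g₂ + g₃ J) = g₀ + g₁ J`. Multiplying on the right by `g₂ - g₃ J` solves
  -- for `K`, by right alternativity and `J² = -1`.
  have hK : (g₂ ^ 2 + g₃ ^ 2) • K = (g₀ * g₂ + g₁ * g₃) • (1 : Octonion) +
      (g₁ * g₂ - g₀ * g₃) • J := by
    have h' := congrArg (fun x => mulBilin x (g₂ • (1 : Octonion) - g₃ • J)) h
    simp only [map_add, map_sub, map_smul, map_zero, LinearMap.add_apply, LinearMap.sub_apply,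
      LinearMap.smul_apply, LinearMap.zero_apply, mulBilin_apply, Octonion.mul_one,
      Octonion.one_mul, mul_mul_self, hJ] at h'
    rw [← mulBilin_apply K (-1), map_neg, mulBilin_apply, Octonion.mul_one] at h'
    rw [smul_zero, smul_zero, sub_zero] at h'
    rw [← sub_eq_zero, ← neg_eq_zero, ← h']
    module
  -- With `K` in the span of `1` and `J`, left alternativity kills `[K, J, p]`.
  have h0 : (g₂ ^ 2 + g₃ ^ 2) • ((K * J) * p - K * (J * p)) = 0 := by
    have h' : mulBilin (mulBilin ((g₂ ^ 2 + g₃ ^ 2) • K) J) p -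
        mulBilin ((g₂ ^ 2 + g₃ ^ 2) • K) (J * p) = 0 := by
      rw [hK]
      simp only [map_add, map_smul, LinearMap.add_apply, LinearMap.smul_apply, mulBilin_apply,
        Octonion.one_mul, mul_self_mul]
      abel
    simpa only [map_smul, LinearMap.smul_apply, mulBilin_apply, ← smul_sub] using h'
  rw [(smul_eq_zero.mp h0).resolve_left hN, smul_zero]

end Octonion

/-! ### The real part of a bimodule, and functionals that kill associators. -/

section Bimodule

variable {M : Type*} [AddCommGroup M] [Module ℝ M] [OctBimodule M]

theorem lmul_lmul_of_mem_octRe {x : M} (hx : x ∈ octRe M) (p q : Octonion) :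
    lmul p (lmul q x) = lmul (p * q) x :=
  (sub_eq_zero.mp (hx p q)).symm

theorem rmul_rmul_of_mem_octRe {x : M} (hx : x ∈ octRe M) (p q : Octonion) :
    rmul (rmul x p) q = rmul x (p * q) := by
  have h := hx p q
  rw [left_eq_right] at h
  exact sub_eq_zero.mp h

theorem rmul_lmul_of_mem_octRe {x : M} (hx : x ∈ octRe M) (p q : Octonion) :
    rmul (lmul q x) p = lmul q (rmul x p) := by
  have h := hx p q
  rw [left_eq_middle] at h
  exact sub_eq_zero.mp h

/-- `[q, r, x p] = x [p, q, r]` for real `x`. -/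
theorem assoc_rmul_of_mem_octRe {x : M} (hx : x ∈ octRe M) (p q r : Octonion) :
    lmul (q * r) (rmul x p) - lmul q (lmul r (rmul x p)) =
      rmul x ((p * q) * r - p * (q * r)) := by
  rw [left_eq_right, map_sub]
  simp only [rmul_rmul_of_mem_octRe hx]

/-- Elements of the real part commute with the octonions. -/
theorem lmul_eq_rmul_of_mem_octRe {x : M} (hx : x ∈ octRe M) (p : Octonion) :
    lmul p x = rmul x p := by
  let S : Submodule ℝ Octonion := LinearMap.eqLocus (lmul.flip x) (rmul x)
  have hS : S = ⊤ := by
    apply Octonion.eq_top_of_one_mem_of_assoc_mem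
    · change lmul 1 x = rmul x 1
      rw [one_lmul, rmul_one]
    · intro p q r
      change lmul _ x = rmul x _
      rw [← assoc_rmul_of_mem_octRe hx, map_sub, LinearMap.sub_apply]
      -- `[p, q, r] x = [p, q, r x] = [q, r x, p] = [q, r, x p] = x [p, q, r]`, where reality of `x`
      -- moves the scalars.
      have h := left_eq_middle p q (lmul r x)
      simpa only [lmul_lmul_of_mem_octRe hx, rmul_lmul_of_mem_octRe hx] using h
  have : p ∈ S := hS ▸ Submodule.mem_top
  exact this

/-- The dual of an `𝕆`-bimodule, with `(p φ)(m) = φ(m p)` and `(φ p)(m) = φ(p m)`. -/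
@[reducible] noncomputable def dualOctBimodule (M : Type*) [AddCommGroup M] [Module ℝ M]
    [OctBimodule M] : OctBimodule (Module.Dual ℝ M) where
  rmul := (LinearMap.llcomp ℝ M M ℝ).compl₂ lmul
  rmul_one φ := by
    ext m
    exact congrArg φ (one_lmul m)
  rmul_alt φ p q := by
    ext m
    have h := congrArg φ (left_alt p q m)
    simp only [map_sub, map_neg] at h
    change φ (lmul p (lmul q m)) - φ (lmul (p * q) m) =
      -(φ (lmul q (lmul p m)) - φ (lmul (q * p) m))
    linarith
  lmul := ((LinearMap.llcomp ℝ M M ℝ).compl₂ rmul.flip).flip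
  one_lmul φ := by
    ext m
    exact congrArg φ (rmul_one m)
  left_eq_middle p q φ := by
    ext m
    have h := congrArg φ ((left_alt p q m).trans (congrArg Neg.neg (left_eq_middle q p m)))
    rw [left_eq_right] at h
    simp only [map_sub, map_neg] at h
    change φ (rmul m (p * q)) - φ (rmul (rmul m p) q) =
      φ (rmul (lmul p m) q) - φ (lmul p (rmul m q))
    linarith
  left_eq_right p q φ := by
    ext m
    have h := congrArg φ (left_eq_right p q m)
    simp only [map_sub] at h
    change φ (rmul m (p * q)) - φ (rmul (rmul m p) q) =
      φ (lmul p (lmul q m)) - φ (lmul (p * q) m)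
    linarith
  left_alt p q φ := by
    ext m
    have h := congrArg φ (rmul_alt m p q)
    simp only [map_sub, map_neg] at h
    change φ (rmul m (p * q)) - φ (rmul (rmul m p) q) =
      -(φ (rmul m (q * p)) - φ (rmul (rmul m q) p))
    linarith

/-- A functional that kills all associators is invariant under the real part operator. -/
theorem apply_reOp_of_apply_rmul_rmul {φ : Module.Dual ℝ M}
    (hφ : ∀ (m : M) (p q : Octonion), φ (rmul (rmul m p) q) = φ (rmul m (p * q))) (m : M) :
    φ (reOp m) = φ m := by
  have hcomm : ∀ (p : Octonion) (w : M), φ (rmul w p) = φ (lmul p w) := by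
    -- The hypothesis says that `φ` is real in the dual bimodule; commuting with octonions there
    -- means `φ (w p) = φ (p w)`.
    let _ := dualOctBimodule M
    have hmem : φ ∈ octRe (Module.Dual ℝ M) := by
      intro p q
      ext w
      exact sub_eq_zero.mpr (hφ w p q).symm
    exact fun p w => LinearMap.congr_fun (lmul_eq_rmul_of_mem_octRe hmem p) w
  have hl : ∀ (p q : Octonion) (w : M), φ (lmul p (lmul q w)) = φ (lmul (p * q) w) := by
    intro p q w
    have h := congrArg φ (left_eq_right p q w)
    rw [map_sub, map_sub, hφ, sub_self, sub_eq_zero] at h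
    exact h.symm
  -- Under `φ` each of the seven terms becomes `e_i² m = -m`, and `5/12 + 7/12 = 1`.
  have hi : ∀ i : Fin 7, φ (rmul (lmul (Octonion.e i.succ) m) (Octonion.e i.succ)) = -φ m := by
    intro i
    rw [hcomm, hl, Octonion.e_mul_e_self, map_neg, LinearMap.neg_apply, one_lmul, map_neg]
  unfold reOp
  rw [map_sub, map_smul, map_smul, map_sum, Finset.sum_congr rfl fun i _ => hi i]
  simp only [Finset.sum_const, Finset.card_univ, Fintype.card_fin, smul_eq_mul, nsmul_eq_mul]
  push_cast
  ring

/-- A functional that kills all associators vanishes on `x p` for real `x` and imaginary `p`. -/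
theorem apply_rmul_of_apply_rmul_rmul {φ : Module.Dual ℝ M}
    (hφ : ∀ (m : M) (p q : Octonion), φ (rmul (rmul m p) q) = φ (rmul m (p * q)))
    {x : M} (hx : x ∈ octRe M) (p : Octonion) : φ (rmul x p) = p 0 * φ x := by
  let S : Submodule ℝ Octonion :=
    { carrier := {p | φ (rmul x p) = p 0 * φ x}
      add_mem' := by
        intro a b ha hb
        simp only [Set.mem_ofPred_eq] at ha hb ⊢
        rw [map_add, map_add, ha, hb, Octonion.add_coord]
        ring
      zero_mem' := by simp [Octonion.zero_coord]
      smul_mem' := by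
        intro c a ha
        simp only [Set.mem_ofPred_eq] at ha ⊢
        rw [map_smul, map_smul, ha, Octonion.smul_coord, smul_eq_mul]
        ring }
  have hS : S = ⊤ := by
    apply Octonion.eq_top_of_one_mem_of_assoc_mem
    · change φ (rmul x 1) = (1 : Octonion) 0 * φ x
      rw [rmul_one, Octonion.one_coord, if_pos rfl, one_mul]
    · intro p q r
      change φ (rmul x _) = _ * φ x
      -- Both sides vanish: `x [p, q, r] = [q, r, x p]` is an associator in `M`, and `Re [p, q, r] =
      -- 0`.
      rw [← assoc_rmul_of_mem_octRe hx, left_eq_right, map_sub, hφ, sub_self,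
        Octonion.sub_coord, Octonion.re_mul_assoc, sub_self, zero_mul]
  have : p ∈ S := hS ▸ Submodule.mem_top
  exact this

end Bimodule

/-! ### Inner products and para-linear operators tested against real vectors. -/

section Hilbert

variable {H : Type*} [NormedAddCommGroup H] [InnerProductSpace ℝ H] [OctPreHilbertBimodule H]

theorem re_oinner_mul (u x : H) (p : Octonion) : (oinner u x * p) 0 = inner ℝ u (rmul x p) := by
  have h := oinner_para u p x
  rw [Octonion.reOp_eq, Octonion.ofReal] at h
  have h0 := congrFun h 0
  simp only [Octonion.smul_coord, Octonion.one_coord, if_pos, mul_one] at h0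
  rw [← re_oinner, ← sub_eq_zero]
  exact h0

theorem inner_rmul (u x : H) (p : Octonion) :
    inner ℝ u (rmul x p) = inner ℝ (rmul u (Octonion.conj p)) x := by
  rw [← re_oinner_mul, real_inner_comm, ← re_oinner_mul, oinner_conj u x, Octonion.re_mul_comm,
    ← Octonion.conj_conj p, ← Octonion.conj_mul, Octonion.conj_coord0, Octonion.conj_conj]

/-- Right multiplication by `p` has adjoint right multiplication by `p̄`; once moved onto the real
vector `u`, the multiplications associate. -/
theorem inner_rmul_rmul_of_mem_octRe {u : H} (hu : u ∈ octRe H) (m : H) (p q : Octonion) :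
    inner ℝ u (rmul (rmul m p) q) = inner ℝ u (rmul m (p * q)) := by
  rw [inner_rmul, inner_rmul, inner_rmul, rmul_rmul_of_mem_octRe hu, Octonion.conj_mul]

theorem inner_reOp_of_mem_octRe {u : H} (hu : u ∈ octRe H) (m : H) :
    inner ℝ u (reOp m) = inner ℝ u m :=
  apply_reOp_of_apply_rmul_rmul (φ := innerₗ H u) (inner_rmul_rmul_of_mem_octRe hu) m

/-- The inner product of two elements of the real part is real. -/
theorem oinner_of_mem_octRe {u v : H} (hu : u ∈ octRe H) (hv : v ∈ octRe H) :
    oinner u v = (inner ℝ u v : ℝ) • (1 : Octonion) := by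
  apply Octonion.ext_of_re_mul
  intro p
  rw [re_oinner_mul, ← Octonion.mulBilin_apply, map_smul, LinearMap.smul_apply,
    Octonion.mulBilin_apply, Octonion.one_mul, Octonion.smul_coord, mul_comm]
  exact apply_rmul_of_apply_rmul_rmul (φ := innerₗ H u) (inner_rmul_rmul_of_mem_octRe hu) hv p

/-- The defect `B_p(T, x)` has zero real part, and pairing with a real `u` depends only on the real
part. -/
theorem IsRightParaLinear.inner_rmul {T : H →ₗ[ℝ] H} (hT : IsRightParaLinear T) {u : H}
    (hu : u ∈ octRe H) (x : H) (p : Octonion) :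
    inner ℝ u (rmul (T x) p) = inner ℝ u (T (rmul x p)) := by
  have h := inner_reOp_of_mem_octRe hu (secondAssoc p T x)
  rw [hT p x, inner_zero_right, secondAssoc, inner_sub_right] at h
  exact sub_eq_zero.mp h.symm

/-- `⟨u q, T (v p)⟩ = q̄ (⟨u, T v⟩ p)` for real `u, v`. -/
theorem IsRightParaLinear.oinner_rmul_rmul {T : H →ₗ[ℝ] H} (hT : IsRightParaLinear T) {u v : H}
    (hu : u ∈ octRe H) (hv : v ∈ octRe H) (p q : Octonion) :
    oinner (rmul u q) (T (rmul v p)) = Octonion.conj q * (oinner u (T v) * p) := by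
  apply Octonion.ext_of_re_mul
  intro r
  -- Collecting all scalars on the real vector `u` is what allows them to pass through `T`.
  have hq : rmul (rmul u q) (Octonion.conj r) =
      rmul u (Octonion.conj (r * Octonion.conj q)) := by
    rw [rmul_rmul_of_mem_octRe hu, Octonion.conj_mul, Octonion.conj_conj]
  rw [re_oinner_mul, _root_.inner_rmul, hq, ← _root_.inner_rmul, hT.inner_rmul hu,
    rmul_rmul_of_mem_octRe hv, ← hT.inner_rmul hu, ← re_oinner_mul, ← Octonion.re_mul_assoc,
    ← Octonion.re_mul_assoc, Octonion.re_mul_comm _ (Octonion.conj q)]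
  exact (Octonion.re_mul_assoc _ _ _).symm

theorem IsRightParaLinear.id : IsRightParaLinear (LinearMap.id : H →ₗ[ℝ] H) := by
  intro p x
  simp [secondAssoc, reOp]

theorem oinner_rmul_rmul {u v : H} (hu : u ∈ octRe H) (hv : v ∈ octRe H) (p q : Octonion) :
    oinner (rmul u q) (rmul v p) = (inner ℝ u v : ℝ) • (Octonion.conj q * p) := by
  have h := (IsRightParaLinear.id (H := H)).oinner_rmul_rmul hu hv p q
  simp only [LinearMap.id_apply] at h
  rw [h, oinner_of_mem_octRe hu hv]
  simp only [← Octonion.mulBilin_apply, map_smul, LinearMap.smul_apply]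
  rw [Octonion.mulBilin_apply 1, Octonion.one_mul]

/-- In the real part of `(⟨y, ·⟩ ⊚ T)(x)` only the `e₀` term survives. -/
theorem IsOctSelfAdjoint.inner_apply [CompleteSpace H] {T : H →L[ℝ] H} (hT : IsOctSelfAdjoint T)
    (y x : H) : inner ℝ (T y) x = inner ℝ y (T x) := by
  have h1 : Octonion.conj (Octonion.e 0) = 1 := by
    apply Octonion.ext8 <;>
      simp [Octonion.conj_coord0, Octonion.conj_coord1, Octonion.conj_coord2,
        Octonion.conj_coord3, Octonion.conj_coord4, Octonion.conj_coord5, Octonion.conj_coord6,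
        Octonion.conj_coord7, Octonion.e_coord, Octonion.one_coord]
  rw [← re_oinner, hT y, octAdjoint_spec]
  unfold regularComp
  simp only [Octonion.lmul_eq, Octonion.reOp_eq, ContinuousLinearMap.coe_coe]
  rw [Fin.sum_univ_eight]
  simp [Octonion.mul_coord0, Octonion.add_coord, Octonion.ofReal, Octonion.smul_coord,
    Octonion.e_coord, Octonion.one_coord, h1, rmul_one, re_oinner]

/-- Octonionic symmetry `⟨v, T u⟩ = ⟨T v, u⟩` holds when `v` is real; this is why only an associator
survives for slice paravectors. -/
theorem oinner_apply_conj {T : H →L[ℝ] H} (hpara : IsRightParaLinear T.toLinearMap)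
    (hsym : ∀ y x : H, inner ℝ (T y) x = inner ℝ y (T x)) {u v : H}
    (hv : v ∈ octRe H) :
    oinner v (T u) = Octonion.conj (oinner u (T v)) := by
  apply Octonion.ext_of_re_mul
  intro p
  rw [← oinner_conj, re_oinner_mul, re_oinner_mul, hsym]
  exact hpara.inner_rmul hv u p

end Hilbert

/-! ### Imaginary units and conjugation. -/

namespace Octonion

theorem mul_self_of_mem_imSphere {J : Octonion} (hJ : J ∈ imSphere) : J * J = -1 := by
  obtain ⟨h0, h1⟩ := hJ
  rw [modulus, Real.sqrt_eq_one] at h1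
  simp only [mul_coord0, conj_coord0, conj_coord1, conj_coord2, conj_coord3, conj_coord4,
    conj_coord5, conj_coord6, conj_coord7] at h1
  apply ext8 <;> simp [mul_coord0, mul_coord1, mul_coord2, mul_coord3, mul_coord4, mul_coord5,
    mul_coord6, mul_coord7, neg_coord, one_coord, h0] <;> first | (ring; done) | (rw [h0] at h1; linarith)

theorem conj_of_mem_imSphere {J : Octonion} (hJ : J ∈ imSphere) : conj J = -J := by
  have h0 : J 0 = 0 := hJ.1
  apply ext8 <;> simp [conj_coord0, conj_coord1, conj_coord2, conj_coord3, conj_coord4,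
    conj_coord5, conj_coord6, conj_coord7, neg_coord, h0]

theorem conj_one : conj 1 = 1 := by
  apply ext8 <;> simp [conj_coord0, conj_coord1, conj_coord2, conj_coord3, conj_coord4,
    conj_coord5, conj_coord6, conj_coord7, one_coord]

theorem conj_smul (r : ℝ) (x : Octonion) : conj (r • x) = r • conj x := by
  apply ext8 <;> simp [conj_coord0, conj_coord1, conj_coord2, conj_coord3, conj_coord4,
    conj_coord5, conj_coord6, conj_coord7, smul_coord]

theorem conj_add (x y : Octonion) : conj (x + y) = conj x + conj y := by
  apply ext8 <;> simp [conj_coord0, conj_coord1, conj_coord2, conj_coord3, conj_coord4,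
    conj_coord5, conj_coord6, conj_coord7, add_coord] <;> ring

theorem conj_sub (x y : Octonion) : conj (x - y) = conj x - conj y := by
  apply ext8 <;> simp [conj_coord0, conj_coord1, conj_coord2, conj_coord3, conj_coord4,
    conj_coord5, conj_coord6, conj_coord7, sub_coord] <;> ring

theorem eq_ofReal_of_conj_eq {x : Octonion} (h : conj x = x) : x = ofReal (x 0) := by
  have hc := congrFun h
  have h1 := hc 1
  have h2 := hc 2
  have h3 := hc 3
  have h4 := hc 4
  have h5 := hc 5
  have h6 := hc 6
  have h7 := hc 7
  rw [conj_coord1] at h1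
  rw [conj_coord2] at h2
  rw [conj_coord3] at h3
  rw [conj_coord4] at h4
  rw [conj_coord5] at h5
  rw [conj_coord6] at h6
  rw [conj_coord7] at h7
  apply ext8 <;> simp [ofReal, smul_coord, one_coord] <;> linarith

theorem mul_self_assoc_self (x y : Octonion) : (x * y) * x = x * (y * x) := by
  apply ext8 <;>
    simp only [mul_coord0, mul_coord1, mul_coord2, mul_coord3, mul_coord4, mul_coord5, mul_coord6,
      mul_coord7] <;> ring

end Octonion

/-! ### Slice paravectors and strong eigenvectors. -/

section Hilbert

variable {H : Type*} [NormedAddCommGroup H] [InnerProductSpace ℝ H] [OctPreHilbertBimodule H]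

/-- The sesquilinear expansion of `⟨y, T x⟩` on slice paravectors. -/
theorem IsRightParaLinear.oinner_apply_slice {T : H →ₗ[ℝ] H} (hT : IsRightParaLinear T)
    {u₁ v₁ u₂ v₂ : H} (hu₁ : u₁ ∈ octRe H) (hv₁ : v₁ ∈ octRe H) (hu₂ : u₂ ∈ octRe H)
    (hv₂ : v₂ ∈ octRe H) {K : Octonion} (hK : Octonion.conj K = -K) (J : Octonion) :
    oinner (u₂ + rmul v₂ K) (T (u₁ + rmul v₁ J)) =
      oinner u₂ (T u₁) + oinner u₂ (T v₁) * J - K * oinner v₂ (T u₁) -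
        K * (oinner v₂ (T v₁) * J) := by
  have h1 := hT.oinner_rmul_rmul hu₂ hv₁ J 1
  have h2 := hT.oinner_rmul_rmul hv₂ hu₁ 1 K
  have h3 := hT.oinner_rmul_rmul hv₂ hv₁ J K
  rw [rmul_one, Octonion.conj_one, Octonion.one_mul] at h1
  rw [rmul_one, hK, Octonion.mul_one] at h2
  rw [hK] at h3
  rw [map_add, map_add, map_add, LinearMap.add_apply, LinearMap.add_apply, h1, h2, h3]
  simp only [← Octonion.mulBilin_apply, map_neg, LinearMap.neg_apply]
  abel

/-- The sesquilinear expansion of `⟨z₂, z₁ p⟩` on slice paravectors. -/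
theorem oinner_rmul_slice {u₁ v₁ u₂ v₂ : H} (hu₁ : u₁ ∈ octRe H) (hv₁ : v₁ ∈ octRe H)
    (hu₂ : u₂ ∈ octRe H) (hv₂ : v₂ ∈ octRe H) {K : Octonion} (hK : Octonion.conj K = -K)
    (J p : Octonion) :
    oinner (u₂ + rmul v₂ K) (rmul (u₁ + rmul v₁ J) p) =
      (inner ℝ u₂ u₁ : ℝ) • p + (inner ℝ u₂ v₁ : ℝ) • (J * p) - (inner ℝ v₂ u₁ : ℝ) • (K * p) -
        (inner ℝ v₂ v₁ : ℝ) • (K * (J * p)) := by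
  have h0 := oinner_rmul_rmul hu₂ hu₁ p 1
  have h1 := oinner_rmul_rmul hu₂ hv₁ (J * p) 1
  have h2 := oinner_rmul_rmul hv₂ hu₁ p K
  have h3 := oinner_rmul_rmul hv₂ hv₁ (J * p) K
  rw [rmul_one, Octonion.conj_one, Octonion.one_mul] at h0 h1
  rw [hK] at h2 h3
  rw [map_add rmul, LinearMap.add_apply, map_add, map_add, LinearMap.add_apply,
    LinearMap.add_apply, rmul_rmul_of_mem_octRe hv₁, h0, h1, h2, h3]
  simp only [← Octonion.mulBilin_apply, map_neg, LinearMap.neg_apply, smul_neg]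
  abel

theorem oinner_slice {u₁ v₁ u₂ v₂ : H} (hu₁ : u₁ ∈ octRe H) (hv₁ : v₁ ∈ octRe H)
    (hu₂ : u₂ ∈ octRe H) (hv₂ : v₂ ∈ octRe H) {K : Octonion} (hK : Octonion.conj K = -K)
    (J : Octonion) :
    oinner (u₂ + rmul v₂ K) (u₁ + rmul v₁ J) =
      (inner ℝ u₂ u₁ : ℝ) • (1 : Octonion) + (inner ℝ u₂ v₁ : ℝ) • J - (inner ℝ v₂ u₁ : ℝ) • K -
        (inner ℝ v₂ v₁ : ℝ) • (K * J) := by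
  simpa only [rmul_one, Octonion.mul_one] using oinner_rmul_slice hu₁ hv₁ hu₂ hv₂ hK J 1

/-- `B_p(z₂, z₁) = -⟨v₂, v₁⟩ [K, J, p]` for slice paravectors `z₁ = u₁ + v₁ J`, `z₂ = u₂ + v₂ K`. -/
theorem innerAssoc_slice {u₁ v₁ u₂ v₂ : H} (hu₁ : u₁ ∈ octRe H) (hv₁ : v₁ ∈ octRe H)
    (hu₂ : u₂ ∈ octRe H) (hv₂ : v₂ ∈ octRe H) {K : Octonion} (hK : Octonion.conj K = -K)
    (J p : Octonion) :
    innerAssoc p (u₂ + rmul v₂ K) (u₁ + rmul v₁ J) =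
      -((inner ℝ v₂ v₁ : ℝ) • ((K * J) * p - K * (J * p))) := by
  rw [innerAssoc, secondAssoc, oinner_rmul_slice hu₁ hv₁ hu₂ hv₂ hK,
    oinner_slice hu₁ hv₁ hu₂ hv₂ hK, Octonion.rmul_eq]
  simp only [← Octonion.mulBilin_apply, map_add, map_sub, map_smul, LinearMap.add_apply,
    LinearMap.sub_apply, LinearMap.smul_apply]
  rw [Octonion.mulBilin_apply 1, Octonion.one_mul]
  module

theorem exists_rmul_of_mem_sliceCone {z : H} (hz : z ∈ sliceCone H) :
    ∃ J ∈ Octonion.imSphere, ∃ u ∈ octRe H, ∃ v ∈ octRe H, z = u + rmul v J := by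
  obtain ⟨J, hJ, u, hu, v, hv, rfl⟩ := hz
  exact ⟨J, hJ, u, hu, v, hv, by rw [lmul_eq_rmul_of_mem_octRe hv]⟩

/-- Only one unit `J` occurs, and `[J, J, p] = 0`. -/
theorem innerAssoc_self_of_mem_sliceCone {z : H} (hz : z ∈ sliceCone H) (p : Octonion) :
    innerAssoc p z z = 0 := by
  obtain ⟨J, hJ, u, hu, v, hv, rfl⟩ := exists_rmul_of_mem_sliceCone hz
  rw [innerAssoc_slice hu hv hu hv (Octonion.conj_of_mem_imSphere hJ), Octonion.mul_self_mul,
    sub_self, smul_zero, neg_zero]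

/-- `B_p` vanishes on orthogonal slice paravectors. -/
theorem innerAssoc_eq_zero_of_oinner_eq_zero {z₁ z₂ : H} (hz₁ : z₁ ∈ sliceCone H)
    (hz₂ : z₂ ∈ sliceCone H) (h : oinner z₂ z₁ = 0) (p : Octonion) : innerAssoc p z₂ z₁ = 0 := by
  obtain ⟨J, hJ, u₁, hu₁, v₁, hv₁, rfl⟩ := exists_rmul_of_mem_sliceCone hz₁
  obtain ⟨K, hK, u₂, hu₂, v₂, hv₂, rfl⟩ := exists_rmul_of_mem_sliceCone hz₂
  have hK' := Octonion.conj_of_mem_imSphere hK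
  rw [oinner_slice hu₁ hv₁ hu₂ hv₂ hK'] at h
  rw [innerAssoc_slice hu₁ hv₁ hu₂ hv₂ hK',
    Octonion.smul_assoc_eq_zero (Octonion.mul_self_of_mem_imSphere hJ) _ _ _ _ h, neg_zero]

/-- `⟨z₂, T z₁⟩ - ⟨T z₂, z₁⟩ = [K, ⟨v₂, T v₁⟩, J]` for slice paravectors. -/
theorem oinner_apply_sub_slice {T : H →L[ℝ] H} (hT : IsRightParaLinear T.toLinearMap)
    (hsym : ∀ y x : H, inner ℝ (T y) x = inner ℝ y (T x))
    {u₁ v₁ u₂ v₂ : H} (hu₁ : u₁ ∈ octRe H) (hv₁ : v₁ ∈ octRe H)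
    (hu₂ : u₂ ∈ octRe H) (hv₂ : v₂ ∈ octRe H) {J K : Octonion} (hJ : Octonion.conj J = -J)
    (hK : Octonion.conj K = -K) :
    oinner (u₂ + rmul v₂ K) (T (u₁ + rmul v₁ J)) - oinner (T (u₂ + rmul v₂ K)) (u₁ + rmul v₁ J) =
      (K * oinner v₂ (T v₁)) * J - K * (oinner v₂ (T v₁) * J) := by
  have h1 := hT.oinner_apply_slice hu₁ hv₁ hu₂ hv₂ hK J
  have h2 := hT.oinner_apply_slice hu₂ hv₂ hu₁ hv₁ hJ K
  simp only [ContinuousLinearMap.coe_coe] at h1 h2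
  rw [oinner_conj (T _), h1, h2, Octonion.conj_sub, Octonion.conj_sub, Octonion.conj_add]
  simp only [Octonion.conj_mul, ← oinner_apply_conj hT hsym hu₂, ← oinner_apply_conj hT hsym hv₂,
    hJ, hK]
  simp only [← Octonion.mulBilin_apply, map_neg, LinearMap.neg_apply]
  abel

/-- Strong eigenvalues are real. -/
theorem IsStrongEigenpair.eq_ofReal {T : H →L[ℝ] H} (hT : IsRightParaLinear T.toLinearMap)
    (hsym : ∀ y x : H, inner ℝ (T y) x = inner ℝ y (T x)) {lam : Octonion} {z : H}
    (h : IsStrongEigenpair T lam z) : ∃ r : ℝ, lam = Octonion.ofReal r := by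
  obtain ⟨hz, hz0, hTz⟩ := h
  have hsub : oinner z (T z) - oinner (T z) z = 0 := by
    obtain ⟨J, hJ, u, hu, v, hv, rfl⟩ := exists_rmul_of_mem_sliceCone hz
    have hJ' := Octonion.conj_of_mem_imSphere hJ
    rw [oinner_apply_sub_slice hT hsym hu hv hu hv hJ' hJ', Octonion.mul_self_assoc_self, sub_self]
  have hB : oinner z (rmul z lam) = oinner z z * lam :=
    (sub_eq_zero.mp (innerAssoc_self_of_mem_sliceCone hz lam)).symm
  obtain ⟨r, -, hr⟩ := oinner_pos z
  have hr0 : r ≠ 0 := by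
    rintro rfl
    rw [Octonion.ofReal, zero_smul, oinner_self_eq_zero] at hr
    exact hz0 hr
  -- The symmetry becomes `r (λ - λ̄) = 0` with `r = ⟨z, z⟩ ≠ 0`.
  rw [hTz, oinner_conj (rmul z lam), hB, hr, Octonion.ofReal, ← Octonion.mulBilin_apply, map_smul,
    LinearMap.smul_apply, Octonion.mulBilin_apply, Octonion.one_mul, Octonion.conj_smul,
    ← smul_sub] at hsub
  exact ⟨_, Octonion.eq_ofReal_of_conj_eq
    (sub_eq_zero.mp ((smul_eq_zero.mp hsub).resolve_left hr0)).symm⟩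

/-- Strong eigenvectors with distinct strong eigenvalues are orthogonal. -/
theorem IsStrongEigenpair.oinner_eq_zero {T : H →L[ℝ] H} (hT : IsRightParaLinear T.toLinearMap)
    (hsym : ∀ y x : H, inner ℝ (T y) x = inner ℝ y (T x)) {r₁ r₂ : ℝ} {z₁ z₂ : H}
    (h₁ : IsStrongEigenpair T (Octonion.ofReal r₁) z₁)
    (h₂ : IsStrongEigenpair T (Octonion.ofReal r₂) z₂) (hr : r₁ ≠ r₂) : oinner z₂ z₁ = 0 := by
  obtain ⟨hz₁, -, hT₁⟩ := h₁
  obtain ⟨hz₂, -, hT₂⟩ := h₂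
  rw [Octonion.ofReal, map_smul, rmul_one] at hT₁ hT₂
  have hX : (r₁ - r₂) • oinner z₂ z₁ = oinner z₂ (T z₁) - oinner (T z₂) z₁ := by
    rw [hT₁, hT₂, map_smul, map_smul, LinearMap.smul_apply, sub_smul]
  apply Octonion.eq_zero_of_conj_mul_self
  -- The left side is `(r₁ - r₂) |⟨z₂, z₁⟩|²`; rewriting one factor as `[K, a, J]` exhibits it as a
  -- pairing of orthogonal octonions.
  have h : (Octonion.conj (oinner z₂ z₁) * ((r₁ - r₂) • oinner z₂ z₁)) 0 = 0 := by
    rw [hX]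
    obtain ⟨J, hJ, u₁, hu₁, v₁, hv₁, rfl⟩ := exists_rmul_of_mem_sliceCone hz₁
    obtain ⟨K, hK, u₂, hu₂, v₂, hv₂, rfl⟩ := exists_rmul_of_mem_sliceCone hz₂
    have hJ' := Octonion.conj_of_mem_imSphere hJ
    have hK' := Octonion.conj_of_mem_imSphere hK
    rw [oinner_apply_sub_slice hT hsym hu₁ hv₁ hu₂ hv₂ hJ' hK', oinner_slice hu₁ hv₁ hu₂ hv₂ hK']
    exact Octonion.re_conj_mul_assoc_eq_zero hJ.1 hK.1 _ _ _ _ _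
  rw [← Octonion.mulBilin_apply, map_smul, Octonion.smul_coord] at h
  exact (mul_eq_zero.mp h).resolve_left (sub_ne_zero.mpr hr)

theorem oinner_normalize_self {z : H} (hz : z ≠ 0) :
    oinner ((‖z‖⁻¹ : ℝ) • z) ((‖z‖⁻¹ : ℝ) • z) = 1 := by
  obtain ⟨r, -, hr⟩ := oinner_pos z
  have h0 := re_oinner z z
  rw [hr, Octonion.ofReal, Octonion.smul_coord, Octonion.one_coord, if_pos rfl, mul_one,
    real_inner_self_eq_norm_sq] at h0
  have hn : ‖z‖ ≠ 0 := norm_ne_zero_iff.mpr hz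
  rw [map_smul, map_smul, LinearMap.smul_apply, hr, Octonion.ofReal, h0, smul_smul, smul_smul]
  rw [show ‖z‖⁻¹ * ‖z‖⁻¹ * ‖z‖ ^ 2 = 1 by field_simp, one_smul]

theorem innerAssoc_smul_smul (p : Octonion) (a b : ℝ) (u v : H) :
    innerAssoc p (a • u) (b • v) = (a * b) • innerAssoc p u v := by
  simp only [innerAssoc, secondAssoc, map_smul, LinearMap.smul_apply, smul_sub, smul_smul,
    mul_comm a b]

end Hilbert

theorem mainTheorem7 {H : Type*} [NormedAddCommGroup H] [InnerProductSpace ℝ H]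
    [CompleteSpace H] [OctPreHilbertBimodule H]
    (T : H →L[ℝ] H) (hpara : IsRightParaLinear T.toLinearMap) (hself : IsOctSelfAdjoint T) :
    (∀ (lam : Octonion) (z : H), IsStrongEigenpair T lam z →
      ∃ r : ℝ, lam = Octonion.ofReal r) ∧
    (∀ (lam₁ lam₂ : Octonion) (z₁ z₂ : H),
      IsStrongEigenpair T lam₁ z₁ → IsStrongEigenpair T lam₂ z₂ → lam₁ ≠ lam₂ →
        tripleAssoc z₂ T z₁ = 0 ∧
        OctPreHilbertBimodule.oinner z₁ z₂ = 0 ∧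
        (∀ p : Octonion, innerAssoc p z₁ z₂ = 0) ∧
        IsWeakAssocOrthonormal ![(‖z₁‖⁻¹ : ℝ) • z₁, (‖z₂‖⁻¹ : ℝ) • z₂]) := by
  have hsym := hself.inner_apply
  refine ⟨fun lam z h => h.eq_ofReal hpara hsym, fun lam₁ lam₂ z₁ z₂ h₁ h₂ hne => ?_⟩
  obtain ⟨r₁, rfl⟩ := h₁.eq_ofReal hpara hsym
  obtain ⟨r₂, rfl⟩ := h₂.eq_ofReal hpara hsym
  have hr : r₁ ≠ r₂ := fun h => hne (by rw [h])
  have h21 : oinner z₂ z₁ = 0 := h₁.oinner_eq_zero hpara hsym h₂ hr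
  have h12 : oinner z₁ z₂ = 0 := h₂.oinner_eq_zero hpara hsym h₁ hr.symm
  have hB21 := innerAssoc_eq_zero_of_oinner_eq_zero h₁.1 h₂.1 h21
  have hB12 := innerAssoc_eq_zero_of_oinner_eq_zero h₂.1 h₁.1 h12
  refine ⟨?_, h12, hB12, ⟨?_, ?_⟩, ?_⟩
  · have hT₁ := h₁.2.2
    have hT₂ := h₂.2.2
    rw [Octonion.ofReal, map_smul, rmul_one] at hT₁ hT₂
    -- Self-adjointness turns the triple associator into `⟨T z₂, z₁⟩ - ⟨z₂, T z₁⟩`, a real multiple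
    -- of `⟨z₂, z₁⟩ = 0`.
    rw [tripleAssoc, compAssoc, ← octAdjoint_spec, ← hself z₂, hT₂]
    change _ - oinner z₂ (T z₁) = 0
    rw [hT₁, map_smul, map_smul, LinearMap.smul_apply, h21, smul_zero, smul_zero, sub_zero]
  · rw [Fin.forall_fin_two]
    exact ⟨oinner_normalize_self h₁.2.1, oinner_normalize_self h₂.2.1⟩
  · rw [Fin.forall_fin_two, Fin.forall_fin_two, Fin.forall_fin_two]
    simp [h12, h21]
  · rw [Fin.forall_fin_two, Fin.forall_fin_two, Fin.forall_fin_two]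
    simp [innerAssoc_smul_smul, hB12, hB21, innerAssoc_self_of_mem_sliceCone h₁.1,
      innerAssoc_self_of_mem_sliceCone h₂.1]
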